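/- A \emph{limit group} is a finitely generated group $\Gamma$ such that for every finite subset $S\subset\Gamma$ there is a homomorphism from $\Gamma$ to a free group whose restriction to $S$ is injective. An action of a group on a tree is \emph{$1$-acylindrical} if every geodesic segment of length greater than $1$ has trivial pointwise stabilizer. Let $\Gamma$ be a limit group which splits as an amalgamated free product $\Gamma=A*_CB$ of subgroups $A,B\le\Gamma$ over a (possibly trivial) cyclic subgroup $C$, and suppose that the splitting is $1$-acylindrical, i.e. that the action of $\Gamma$ on the Bass--Serre tree of the splitting is $1$-acylindrical. Let $\gamma\in\Gamma\smallsetminus A$. Then the subgroup of $\Gamma$ generated by $A$ and $\gamma$ is the free product of its subgroups $A$ and $\langle\gamma\rangle$; that is, the canonical homomorphism $A*\langle\gamma\rangle\to\Gamma$ induced by the inclusions is injective with image $\langle A,\gamma\rangle$. -/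

import Mathlib

universe u

/-- A limit group: a finitely generated group such that every finite subset is mapped injectively
by some homomorphism to a free group. (As the group is finitely generated, the image of such a
homomorphism involves only finitely many letters, so bases in `Type` suffice.) -/
def IsLimitGroup (Γ : Type u) [Group Γ] : Prop :=
  Group.FG Γ ∧ ∀ S : Finset Γ, ∃ (X : Type) (φ : Γ →* FreeGroup X), Set.InjOn φ (S : Set Γ)

/-- The canonical homomorphism to `Γ` from the amalgamated product of a family of subgroups of `Γ`
over a common subgroup `C`, induced by the inclusions. -/
def amalgamMap {Γ : Type u} [Group Γ] {ι : Type*} (H : ι → Subgroup Γ) (C : Subgroup Γ)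
    (h : ∀ i, C ≤ H i) : Monoid.PushoutI (fun i => Subgroup.inclusion (h i)) →* Γ :=
  Monoid.PushoutI.lift (fun i => (H i).subtype) C.subtype (fun _ => rfl)

/-- `Γ = A *_C B`: the subgroup `C` is contained in both `A` and `B`, and the canonical
homomorphism from the amalgamated product of `A` and `B` over `C` to `Γ` is an isomorphism. -/
def IsAmalgamatedProduct {Γ : Type u} [Group Γ] (A B C : Subgroup Γ) : Prop :=
  ∃ h : ∀ i, C ≤ (![A, B] : Fin 2 → Subgroup Γ) i, Function.Bijective (amalgamMap ![A, B] C h)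

/-- The Bass–Serre tree of `Γ = A *_C B`. The vertices are the cosets `gA` and `gB`, and each
`g : Γ` gives an edge between `gA` and `gB`. Two elements `g`, `g'` give the same edge iff
`g⁻¹ * g' ∈ A ⊓ B`; since `A ⊓ B = C` in an amalgamated product, the edges are the cosets `gC`. -/
def bassSerreTree {Γ : Type u} [Group Γ] (A B : Subgroup Γ) :
    SimpleGraph ((Γ ⧸ A) ⊕ (Γ ⧸ B)) where
  Adj x y := ∃ g : Γ, (x = Sum.inl (g : Γ ⧸ A) ∧ y = Sum.inr (g : Γ ⧸ B)) ∨
    (x = Sum.inr (g : Γ ⧸ B) ∧ y = Sum.inl (g : Γ ⧸ A))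
  symm := ⟨fun _ _ ⟨g, h⟩ => ⟨g, h.elim (fun h => Or.inr ⟨h.2, h.1⟩) (fun h => Or.inl ⟨h.2, h.1⟩)⟩⟩
  loopless := ⟨by
    rintro x ⟨g, ⟨h1, h2⟩ | ⟨h1, h2⟩⟩ <;> exact absurd (h1.symm.trans h2) (by simp)⟩

/-- The action of `Γ` on the vertices of the graph `T` is `k`-acylindrical: every geodesic segment
of length greater than `k` has trivial (pointwise) stabilizer. -/
def IsAcylindrical (Γ : Type*) [Group Γ] {V : Type*} [MulAction Γ V] (T : SimpleGraph V)
    (k : ℕ) : Prop :=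
  ∀ (x y : V) (p : T.Walk x y), p.length = T.dist x y → k < p.length →
    ∀ g : Γ, (∀ z ∈ p.support, g • z = z) → g = 1

/-- The subgroup `L` of `Γ` is the (internal) free product of the subgroups `H` and `K`: the
canonical homomorphism `H ∗ K → Γ` is injective with image `L`. -/
def IsInternalFreeProduct {Γ : Type u} [Group Γ] (H K L : Subgroup Γ) : Prop :=
  Function.Injective (Monoid.Coprod.lift H.subtype K.subtype) ∧
    (Monoid.Coprod.lift H.subtype K.subtype).range = L

/-! Acylindricity makes `C` malnormal in `A` and in `B`: conjugation by an element of `A \ C` or `B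
\ C` carries no nontrivial element of `C` into `C` (`IsAcylindrical.isMalnormalIn`). Freeness
follows once no product `γ ^ k₁ * α₁ * ⋯ * γ ^ kᵣ`, with `kᵢ ≠ 0` and `αᵢ ∈ A` nontrivial, lies in
`A` (`generatesFreeProduct_of_forall_not_mem`). By the normal form theorem it is enough to write
each such product as an alternating word with both ends in `B \ C`.

Multiplying `γ` by elements of `A` on either side is harmless (`GeneratesFreeProduct.mul_mul`), so
`γ` itself may be taken to be such a word. Three cases remain. If `γ = b ∈ B \ C` and `C ≠ 1`,
malnormality prevents `b` from commuting with a generator of `C`; in a limit group the two then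
generate a free group of rank two, so `b` and `C` generate their free product inside `B`. If `γ = p
* m * q` and `q * c * p ∉ C` for all `c ∈ C`, consecutive powers of `γ` never cancel beyond merging
into one letter of `B \ C`. If `q * c * p ∈ C` for some `c ∈ C`, then `γ * c` is the conjugate by
`p` of an alternating word with ends in `A \ C`, whose powers remain alternating because `Γ` is
torsion-free. -/

/-! ### Free groups: residual finiteness and non-commuting pairs. -/

/-- Free groups are residually finite: a nontrivial element acts nontrivially on the finite set of
suffixes of a word representing it, for a suitable extension of left multiplication by the
generators to permutations of this set. -/
theorem FreeGroup.exists_finite_map_ne_one {α : Type u} (w : FreeGroup α) (hw : w ≠ 1) :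
    ∃ (G : Type u) (_ : Group G) (_ : Finite G) (φ : FreeGroup α →* G), φ w ≠ 1 := by
  classical
  obtain ⟨L, rfl⟩ : ∃ L, FreeGroup.mk L = w := ⟨w.toWord, FreeGroup.mk_toWord⟩
  let P : Finset (FreeGroup α) := (L.tails.map FreeGroup.mk).toFinset
  have hP : ∀ L' : List (α × Bool), L' <:+ L → FreeGroup.mk L' ∈ P := fun L' h => by
    simp only [P, List.mem_toFinset, List.mem_map, List.mem_tails]
    exact ⟨L', h, rfl⟩
  let e : ∀ a : α, {x : P // FreeGroup.of a * x.1 ∈ P} ≃ {x : P // (FreeGroup.of a)⁻¹ * x.1 ∈ P} :=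
    fun a =>
    { toFun := fun x => ⟨⟨FreeGroup.of a * x.1.1, x.2⟩, by simp⟩
      invFun := fun x => ⟨⟨(FreeGroup.of a)⁻¹ * x.1.1, x.2⟩, by simp⟩
      left_inv := fun x => by simp
      right_inv := fun x => by simp }
  let σ : α → Equiv.Perm P := fun a => (e a).extendSubtype
  have hσ : ∀ (a : α) (x : P) (y : P), y.1 = FreeGroup.of a * x.1 → σ a x = y := by
    intro a x y h
    have hx : FreeGroup.of a * x.1 ∈ P := h ▸ y.2
    rw [Equiv.extendSubtype_apply_of_mem (e a) x hx]
    exact Subtype.ext h.symm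
  let φ : FreeGroup α →* Equiv.Perm P := FreeGroup.lift σ
  have key : ∀ (L' : List (α × Bool)) (h : L' <:+ L),
      φ (FreeGroup.mk L') ⟨1, hP [] List.nil_suffix⟩ = ⟨FreeGroup.mk L', hP L' h⟩ := by
    intro L'
    induction L' with
    | nil => intro _; exact DFunLike.congr_fun (_root_.map_one φ) _
    | cons s L' ih =>
      intro h
      have h' : L' <:+ L := (List.suffix_cons s L').trans h
      have hs : FreeGroup.mk (s :: L') = FreeGroup.mk [s] * FreeGroup.mk L' := by
        rw [FreeGroup.mul_mk]; rfl
      obtain ⟨a, b⟩ := s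
      cases b with
      | true =>
        have hs' : FreeGroup.mk ((a, true) :: L') = FreeGroup.of a * FreeGroup.mk L' := hs
        have : φ (FreeGroup.mk ((a, true) :: L')) = σ a * φ (FreeGroup.mk L') := by
          rw [hs', _root_.map_mul]; simp [φ]
        rw [this, Equiv.Perm.mul_apply, ih h']
        exact hσ a _ _ hs'
      | false =>
        have hs' : FreeGroup.mk ((a, false) :: L') = (FreeGroup.of a)⁻¹ * FreeGroup.mk L' := by
          rw [hs]; rfl
        have : φ (FreeGroup.mk ((a, false) :: L')) = (σ a)⁻¹ * φ (FreeGroup.mk L') := by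
          rw [hs', _root_.map_mul, _root_.map_inv]; simp [φ]
        rw [this, Equiv.Perm.mul_apply, ih h', Equiv.Perm.inv_eq_iff_eq]
        refine (hσ a _ _ ?_).symm
        simp [hs']
  refine ⟨Equiv.Perm P, inferInstance, inferInstance, φ, fun h => hw ?_⟩
  have := key L List.suffix_rfl
  rw [h] at this
  exact (congrArg Subtype.val this).symm

/-- A surjection from the free group of rank two onto a nonabelian free group is injective. -/
theorem FreeGroup.injective_of_surjective_of_not_commute {S : Type*}
    (f : FreeGroup Bool →* FreeGroup S) (hf : Function.Surjective f)
    (hS : ∃ x y : FreeGroup S, x * y ≠ y * x) : Function.Injective f := by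
  classical
  -- Homomorphisms to `G` pull back injectively along the surjection `f`, so `|G| ^ |S| ≤ |G| ^ 2`
  -- for finite `G`. The group of order two bounds `S`; once `|S| = 2`, every map from `FreeGroup
  -- Bool` to a finite `G` factors through `f`, and residual finiteness leaves no kernel.
  have hinj : ∀ (G : Type) [Group G], Function.Injective
      (fun g : S → G => fun b : Bool => FreeGroup.lift g (f (FreeGroup.of b))) := by
    intro G _ g₁ g₂ h
    have h1 : (FreeGroup.lift g₁).comp f = (FreeGroup.lift g₂).comp f := by
      ext b
      exact congrFun h b
    have h2 : FreeGroup.lift g₁ = FreeGroup.lift g₂ := by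
      ext s
      obtain ⟨x, hx⟩ := hf (FreeGroup.of s)
      rw [← hx]
      exact DFunLike.congr_fun h1 x
    exact FreeGroup.lift.injective h2
  have hSnon : ¬ Subsingleton S := by
    intro hss
    obtain ⟨x, y, hxy⟩ := hS
    rcases isEmpty_or_nonempty S with hE | ⟨⟨s⟩⟩
    · exact hxy (Subsingleton.elim _ _)
    · have : Unique S := ⟨⟨s⟩, fun t => Subsingleton.elim _ _⟩
      refine hxy ?_
      have hz : ∀ z : FreeGroup S, z ∈ Subgroup.zpowers (FreeGroup.of s) := by
        intro z
        induction z using FreeGroup.induction_on with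
        | C1 => exact one_mem _
        | of t => rw [Subsingleton.elim t s]; exact Subgroup.mem_zpowers _
        | inv_of t h => exact inv_mem h
        | mul x y hx hy => exact mul_mem hx hy
      obtain ⟨m, rfl⟩ := hz x
      obtain ⟨n, rfl⟩ := hz y
      exact (Commute.refl (FreeGroup.of s)).zpow_zpow m n
  have hfin : Finite S := by
    have h1 : Finite (S → Multiplicative (ZMod 2)) := Finite.of_injective _ (hinj _)
    exact Finite.of_injective (β := S → Multiplicative (ZMod 2))
      (fun s => Pi.mulSingle s (Multiplicative.ofAdd 1)) (fun s t hst => by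
        by_contra hne
        have := congrFun hst s
        simp only [Pi.mulSingle_eq_same, Pi.mulSingle_eq_of_ne hne] at this
        exact absurd this (by decide))
  have : Fintype S := Fintype.ofFinite S
  have hcard : Fintype.card S = Fintype.card Bool := by
    apply le_antisymm
    · have := Fintype.card_le_of_injective _ (hinj (Multiplicative (ZMod 2)))
      simp only [Fintype.card_fun, Fintype.card_multiplicative, ZMod.card] at this
      exact (Nat.pow_le_pow_iff_right (by norm_num)).1 this
    · rw [not_subsingleton_iff_nontrivial, ← Fintype.one_lt_card_iff_nontrivial] at hSnon
      exact hSnon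
  rw [injective_iff_map_eq_one]
  intro w hw
  by_contra hne
  obtain ⟨G, _, _, φ, hφ⟩ := FreeGroup.exists_finite_map_ne_one.{0} w hne
  have : Fintype G := Fintype.ofFinite G
  have hbij := (Fintype.bijective_iff_injective_and_card _).2
    ⟨hinj G, by simp only [Fintype.card_fun, hcard]⟩
  obtain ⟨g, hg⟩ := hbij.2 (fun b => φ (FreeGroup.of b))
  have h1 : (FreeGroup.lift g).comp f = φ := by
    ext b
    exact congrFun hg b
  apply hφ
  rw [← h1, MonoidHom.comp_apply, hw, _root_.map_one]

/-- Two elements of a free group which do not commute generate a free group of rank two. -/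
theorem FreeGroup.lift_injective_of_not_commute {X : Type*} (x : Bool → FreeGroup X)
    (hx : x true * x false ≠ x false * x true) : Function.Injective (FreeGroup.lift x) := by
  let H := (FreeGroup.lift x).range
  let e := IsFreeGroup.toFreeGroup H
  let f : FreeGroup Bool →* FreeGroup (IsFreeGroup.Generators H) :=
    e.toMonoidHom.comp (FreeGroup.lift x).rangeRestrict
  have hf : Function.Injective f := by
    refine FreeGroup.injective_of_surjective_of_not_commute f
      (e.surjective.comp (FreeGroup.lift x).rangeRestrict_surjective)
      ⟨f (FreeGroup.of true), f (FreeGroup.of false), fun h => hx ?_⟩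
    rw [← _root_.map_mul, ← _root_.map_mul] at h
    have h' : FreeGroup.lift x (FreeGroup.of true * FreeGroup.of false) =
        FreeGroup.lift x (FreeGroup.of false * FreeGroup.of true) :=
      congrArg Subtype.val (e.injective h)
    simpa using h'
  intro a b hab
  refine hf (congrArg e ?_)
  exact Subtype.ext hab

/-! ### Alternating words of odd length and their powers. -/

section Alternating

variable {Γ : Type u} [Group Γ]

/-- Products `x₁ x₂ ⋯ xₙ` of odd length whose factors lie alternately in `A \ C` and `B \ C`,
with first and last factor in `A \ C`. -/
inductive OddAlternating (C : Subgroup Γ) : Subgroup Γ → Subgroup Γ → Γ → Prop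
  | single {A B : Subgroup Γ} {x : Γ} : x ∈ A → x ∉ C → OddAlternating C A B x
  | wrap {A B : Subgroup Γ} {x g y : Γ} : x ∈ A → x ∉ C → OddAlternating C B A g →
      y ∈ A → y ∉ C → OddAlternating C A B (x * g * y)

/-- Elements of `A \ C` conjugate nontrivial elements of `C` out of `C`. -/
def IsMalnormalIn (C A : Subgroup Γ) : Prop :=
  ∀ x ∈ A, x ∉ C → ∀ c ∈ C, x * c * x⁻¹ ∈ C → c = 1

namespace OddAlternating

variable {A B C : Subgroup Γ}

theorem inv {g : Γ} (hg : OddAlternating C A B g) : OddAlternating C A B g⁻¹ := by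
  induction hg with
  | single hx hxC => exact single (inv_mem hx) (by simpa using hxC)
  | wrap hx hxC _ hy hyC ih =>
    rw [mul_inv_rev, mul_inv_rev, ← mul_assoc]
    exact wrap (inv_mem hy) (by simpa using hyC) ih (inv_mem hx) (by simpa using hxC)

theorem mul_base {g c : Γ} (hCA : C ≤ A) (hg : OddAlternating C A B g) (hc : c ∈ C) :
    OddAlternating C A B (g * c) := by
  cases hg with
  | single hx hxC =>
    exact single (mul_mem hx (hCA hc)) (by rwa [Subgroup.mul_mem_cancel_right _ hc])
  | wrap hx hxC hg hy hyC =>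
    rw [mul_assoc]
    exact wrap hx hxC hg (mul_mem hy (hCA hc)) (by rwa [Subgroup.mul_mem_cancel_right _ hc])

/-- Moving the odd part of an alternating product of even length to the left. -/
theorem exists_mul_eq {g : Γ} (hg : OddAlternating C B A g) {x : Γ} (hx : x ∈ A) (hxC : x ∉ C) :
    ∃ o y, OddAlternating C A B o ∧ y ∈ B ∧ y ∉ C ∧ x * g = o * y := by
  induction hg generalizing x with
  | single hy hyC => exact ⟨x, _, single hx hxC, hy, hyC, rfl⟩
  | wrap hx₁ hx₁C hg hy₁ hy₁C ih =>
    obtain ⟨o, y, ho, hy, hyC, h⟩ := ih hx₁ hx₁C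
    exact ⟨x * o * y, _, wrap hx hxC ho hy hyC, hy₁, hy₁C, by rw [h]; group⟩

/-- Moving the odd part of an alternating product of even length to the right. -/
theorem exists_mul_eq' {g : Γ} (hg : OddAlternating C A B g) {y : Γ} (hy : y ∈ B) (hyC : y ∉ C) :
    ∃ x o, x ∈ A ∧ x ∉ C ∧ OddAlternating C B A o ∧ g * y = x * o := by
  obtain ⟨o, x, ho, hx, hxC, h⟩ := hg.inv.exists_mul_eq (inv_mem hy) (by simpa using hyC)
  refine ⟨x⁻¹, o⁻¹, inv_mem hx, by simpa using hxC, ho.inv, ?_⟩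
  rw [← mul_inv_rev, ← h]; group

theorem append {g h x : Γ} (hg : OddAlternating C A B g) (hx : x ∈ B) (hxC : x ∉ C)
    (hh : OddAlternating C A B h) : OddAlternating C A B (g * x * h) := by
  induction hg generalizing x h with
  | single hy hyC =>
    obtain ⟨o, z, ho, hz, hzC, e⟩ := hh.exists_mul_eq hx hxC
    rw [mul_assoc, e, ← mul_assoc]
    exact wrap hy hyC ho hz hzC
  | @wrap A B x₁ g y₁ hx₁ hx₁C hg hy₁ hy₁C ih =>
    obtain ⟨o, z, ho, hz, hzC, e⟩ := hh.exists_mul_eq hx hxC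
    have : x₁ * g * y₁ * x * h = x₁ * (g * y₁ * o) * z := by
      rw [mul_assoc _ x h, e]; group
    rw [this]
    exact wrap hx₁ hx₁C (ih hy₁ hy₁C ho) hz hzC

/-- Powers of `x m y`, where no cancellation occurs between `y` and `x`. -/
theorem exists_pow_eq {x m y : Γ} (hx : x ∈ A) (hy : y ∈ A) (hyx : y * x ∉ C)
    (hm : OddAlternating C B A m) (n : ℕ) :
    ∃ z, OddAlternating C B A z ∧ (x * m * y) ^ (n + 1) = x * z * y := by
  induction n with
  | zero => exact ⟨m, hm, by simp⟩
  | succ n ih =>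
    obtain ⟨z, hz, h⟩ := ih
    exact ⟨z * (y * x) * m, hz.append (mul_mem hy hx) hyx hm, by rw [pow_succ, h]; group⟩

theorem pow_not_mem (hA : IsMalnormalIn C A) (htf : ∀ (g : Γ) (n : ℕ), g ^ (n + 1) = 1 → g = 1)
    {x : Γ} (hx : x ∈ A) (hxC : x ∉ C) (n : ℕ) : x ^ (n + 1) ∉ C := by
  intro h
  -- `x` commutes with its own power, so malnormality forces that power to be trivial.
  have h1 : x ^ (n + 1) = 1 := hA x hx hxC _ h (by
    rw [← pow_succ', pow_succ, mul_inv_cancel_right]; exact h)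
  exact hxC (htf x n h1 ▸ one_mem C)

/-- The factor `c` is what the induction needs: if the ends of `x * m * y` cancel in the sense that
`y * c * x ∈ C`, conjugation by `x` leads to powers of the shorter word `m` times this new element
of `C`. -/
theorem mul_pow {g : Γ} (hg : OddAlternating C A B g) (hCA : C ≤ A) (hCB : C ≤ B)
    (hA : IsMalnormalIn C A) (hB : IsMalnormalIn C B)
    (htf : ∀ (g : Γ) (n : ℕ), g ^ (n + 1) = 1 → g = 1) {c : Γ} (hc : c ∈ C) (n : ℕ) :
    OddAlternating C A B ((g * c) ^ (n + 1)) := by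
  induction hg generalizing c with
  | single hx hxC =>
    have hxc := mul_mem hx (hCA hc)
    exact single (pow_mem hxc _)
      (pow_not_mem hA htf hxc (by rwa [Subgroup.mul_mem_cancel_right _ hc]) n)
  | @wrap A B x m y hx hxC hm hy hyC ih =>
    have hyc := mul_mem hy (hCA hc)
    have hycC : y * c ∉ C := by rwa [Subgroup.mul_mem_cancel_right _ hc]
    by_cases hd : y * c * x ∈ C
    · have h := ih hCB hCA hB hA hd
      have e : x * m * y * c = x * (m * (y * c * x)) * x⁻¹ := by group
      rw [e, conj_pow]
      exact wrap hx hxC h (inv_mem hx) (by simpa using hxC)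
    · obtain ⟨z, hz, e⟩ := exists_pow_eq hx hyc hd hm n
      rw [mul_assoc _ y c, e]
      exact wrap hx hxC hz hyc hycC

theorem zpow {g : Γ} (hg : OddAlternating C A B g) (hCA : C ≤ A) (hCB : C ≤ B)
    (hA : IsMalnormalIn C A) (hB : IsMalnormalIn C B)
    (htf : ∀ (g : Γ) (n : ℕ), g ^ (n + 1) = 1 → g = 1) {k : ℤ} (hk : k ≠ 0) :
    OddAlternating C A B (g ^ k) := by
  have h (n : ℕ) : OddAlternating C A B (g ^ (n + 1)) := by
    simpa using hg.mul_pow hCA hCB hA hB htf (one_mem C) n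
  obtain ⟨n, rfl | rfl⟩ := k.eq_nat_or_neg
  all_goals
    obtain ⟨n, rfl⟩ := Nat.exists_eq_succ_of_ne_zero (n := n) (by rintro rfl; simp at hk)
  · rw [zpow_natCast]; exact h n
  · rw [zpow_neg, zpow_natCast]; exact (h n).inv

end OddAlternating

end Alternating

/-! ### Normal forms in the amalgam, and malnormality from acylindricity. -/

section Amalgam

open Monoid

variable {Γ : Type u} [Group Γ] {A B C : Subgroup Γ}

theorem amalgamMap_of {ι : Type*} {H : ι → Subgroup Γ} (hC : ∀ i, C ≤ H i) (i : ι) (x : H i) :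
    amalgamMap H C hC (PushoutI.of i x) = x :=
  PushoutI.lift_of _ _ _ _

theorem amalgamMap_base {ι : Type*} {H : ι → Subgroup Γ} (hC : ∀ i, C ≤ H i) (c : C) :
    amalgamMap H C hC (PushoutI.base _ c) = c :=
  PushoutI.lift_base _ _ _ _

/-- An alternating product of elements of two members of a family of subgroups comes from a reduced
word in the free product of the family. -/
theorem OddAlternating.exists_neWord {ι : Type*} {H : ι → Subgroup Γ} (hC : ∀ i, C ≤ H i)
    {g : Γ} (hg : OddAlternating C A B g) {i j : ι} (hij : i ≠ j) (hA : A = H i) (hB : B = H j) :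
    ∃ w : CoprodI.NeWord (fun i => H i) i i,
      (∀ l ∈ w.toList, l.2 ∉ (Subgroup.inclusion (hC l.1)).range) ∧
      amalgamMap H C hC (PushoutI.ofCoprodI w.prod) = g := by
  have hr {k : ι} {x : H k} (hx : x.1 ∉ C) : x ∉ (Subgroup.inclusion (hC k)).range := by
    rintro ⟨c, rfl⟩; exact hx c.2
  have hone {k : ι} {x : H k} (hx : x.1 ∉ C) : x ≠ 1 := by
    rintro rfl; exact hx (one_mem C)
  induction hg generalizing i j with
  | @single A B x hx hxC =>
    subst hA
    refine ⟨.singleton ⟨x, hx⟩ (hone hxC), ?_, ?_⟩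
    · simpa using hr (x := ⟨x, hx⟩) hxC
    · simp [amalgamMap_of]
  | @wrap A B x g y hx hxC hg hy hyC ih =>
    obtain ⟨w, hw, e⟩ := ih hij.symm hB hA
    subst hA
    refine ⟨.append (.append (.singleton ⟨x, hx⟩ (hone hxC)) hij w) hij.symm
      (.singleton ⟨y, hy⟩ (hone hyC)), ?_, ?_⟩
    · intro l hl
      simp only [CoprodI.NeWord.toList, List.mem_append, List.mem_singleton] at hl
      rcases hl with (rfl | hl) | rfl
      · exact hr (x := ⟨x, hx⟩) hxC
      · exact hw l hl
      · exact hr (x := ⟨y, hy⟩) hyC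
    · simp only [CoprodI.NeWord.append_prod, map_mul, e]
      simp [amalgamMap_of]

theorem not_mem_range_of_neWord {ι : Type*} {H : ι → Subgroup Γ} (hC : ∀ i, C ≤ H i)
    (hinj : Function.Injective (amalgamMap H C hC)) {i j : ι}
    (w : CoprodI.NeWord (fun i => H i) i j)
    (hw : ∀ l ∈ w.toList, l.2 ∉ (Subgroup.inclusion (hC l.1)).range) :
    amalgamMap H C hC (PushoutI.ofCoprodI w.prod) ∉ C := by
  intro hmem
  have h := PushoutI.Reduced.eq_empty_of_mem_range (φ := fun i => Subgroup.inclusion (hC i))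
    (fun i => Subgroup.inclusion_injective (hC i)) (w := w.toWord) hw
    ⟨⟨_, hmem⟩, hinj (amalgamMap_base hC _)⟩
  exact w.toList_ne_nil (congrArg CoprodI.Word.toList h)

/-- The normal form theorem for alternating products of odd length. -/
theorem OddAlternating.not_mem_of_injective {ι : Type*} {H : ι → Subgroup Γ} (hC : ∀ i, C ≤ H i)
    (hinj : Function.Injective (amalgamMap H C hC)) {i j : ι} (hij : i ≠ j) {g : Γ}
    (hg : OddAlternating C (H i) (H j) g) : g ∉ H j := by
  intro hgB
  obtain ⟨w, hw, e⟩ := hg.exists_neWord hC hij rfl rfl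
  have hgC : g ∉ C := by
    rw [← e]; exact not_mem_range_of_neWord hC hinj w hw
  -- If `g` were in `H j`, the word for `g` followed by the letter `g⁻¹` would be reduced with
  -- product `1 ∈ C`.
  have h1 : (⟨g, hgB⟩ : H j)⁻¹ ≠ 1 := by
    rw [inv_ne_one]
    intro h
    have hg1 : g = 1 := congrArg Subtype.val h
    exact hgC (hg1 ▸ one_mem C)
  refine not_mem_range_of_neWord hC hinj (.append w hij (.singleton _ h1)) ?_ ?_
  · intro l hl
    simp only [CoprodI.NeWord.toList, List.mem_append, List.mem_singleton] at hl
    rcases hl with hl | rfl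
    · exact hw l hl
    · rintro ⟨c, hc⟩
      have : (c : Γ) = g⁻¹ := congrArg Subtype.val hc
      exact hgC (by rw [← inv_mem_iff, ← this]; exact c.2)
  · rw [CoprodI.NeWord.append_prod, map_mul, map_mul, e]
    simp [amalgamMap_of]

/-- The normal form theorem and generation, for the two factors of an amalgamated product. -/
theorem IsAmalgamatedProduct.normal_form (h : IsAmalgamatedProduct A B C) :
    C ≤ A ∧ C ≤ B ∧ (∀ g, OddAlternating C A B g → g ∉ B) ∧
      (∀ g, OddAlternating C B A g → g ∉ A) ∧ A ⊔ B = ⊤ := by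
  obtain ⟨hC, hinj, hsurj⟩ := h
  refine ⟨hC 0, hC 1,
    fun g hg => OddAlternating.not_mem_of_injective hC hinj (i := 0) (j := 1) (by decide) hg,
    fun g hg => OddAlternating.not_mem_of_injective hC hinj (i := 1) (j := 0) (by decide) hg, ?_⟩
  rw [eq_top_iff]
  intro g _
  obtain ⟨x, rfl⟩ := hsurj g
  induction x using PushoutI.induction_on with
  | of i x =>
    fin_cases i
    · exact Subgroup.mem_sup_left (by rw [amalgamMap_of]; exact x.2)
    · exact Subgroup.mem_sup_right (by rw [amalgamMap_of]; exact x.2)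
  | base c =>
    exact Subgroup.mem_sup_left (hC 0 (by rw [amalgamMap_base]; exact c.2))
  | mul x y hx hy => rw [map_mul]; exact mul_mem (hx trivial) (hy trivial)

/-- If `A` and `B` generate the group, every element outside `A` is, up to factors in `A`
on both sides, an alternating product which starts and ends in `B`. -/
theorem exists_oddAlternating_of_not_mem (hCA : C ≤ A) (hCB : C ≤ B) (hgen : A ⊔ B = ⊤) (g : Γ) :
    g ∈ A ∨ ∃ a₀ ∈ A, ∃ a₁ ∈ A, ∃ o, OddAlternating C B A o ∧ g = a₀ * o * a₁ := by
  have hg : g ∈ Subgroup.closure ((A : Set Γ) ∪ B) := by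
    rw [← Subgroup.sup_eq_closure, hgen]; trivial
  have step : ∀ b ∈ B, ∀ g : Γ,
      (g ∈ A ∨ ∃ a₀ ∈ A, ∃ a₁ ∈ A, ∃ o, OddAlternating C B A o ∧ g = a₀ * o * a₁) →
      (b * g ∈ A ∨ ∃ a₀ ∈ A, ∃ a₁ ∈ A, ∃ o, OddAlternating C B A o ∧ b * g = a₀ * o * a₁) := by
    intro b hb g hg
    by_cases hbC : b ∈ C
    · rcases hg with hg | ⟨a₀, h₀, a₁, h₁, o, ho, rfl⟩
      · exact Or.inl (mul_mem (hCA hbC) hg)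
      · exact Or.inr ⟨b * a₀, mul_mem (hCA hbC) h₀, a₁, h₁, o, ho, by group⟩
    rcases hg with hg | ⟨a₀, h₀, a₁, h₁, o, ho, rfl⟩
    · exact Or.inr ⟨1, one_mem _, g, hg, b, .single hb hbC, by group⟩
    by_cases h₀C : a₀ ∈ C
    · have hba : b * a₀ ∈ B := mul_mem hb (hCB h₀C)
      cases ho with
      | single hx hxC =>
        by_cases hC : b * a₀ * o ∈ C
        · left
          have := mul_mem (hCA hC) h₁
          simpa only [mul_assoc] using this
        · exact Or.inr ⟨1, one_mem _, a₁, h₁, _, .single (mul_mem hba hx) hC, by group⟩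
      | wrap hx hxC hm hy hyC =>
        rename_i x m y
        -- If so, this letter is absorbed into `A`, and the remaining `m * y` is regrouped as a
        -- letter of `A` times an odd word.
        by_cases hC : b * a₀ * x ∈ C
        · obtain ⟨a, o, ha, -, ho, e⟩ := hm.exists_mul_eq' hy hyC
          refine Or.inr ⟨b * a₀ * x * a, mul_mem (hCA hC) ha, a₁, h₁, o, ho, ?_⟩
          rw [mul_assoc (b * a₀ * x) a o, ← e]; group
        · exact Or.inr ⟨1, one_mem _, a₁, h₁, _, .wrap (mul_mem hba hx) hC hm hy hyC, by group⟩
    · refine Or.inr ⟨1, one_mem _, a₁, h₁, b * a₀ * o, ?_, by group⟩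
      exact OddAlternating.append (.single hb hbC) h₀ h₀C ho
  induction hg using Subgroup.closure_induction_left with
  | one => exact Or.inl (one_mem A)
  | mul_left x hx y _ ih =>
    rcases hx with hx | hx
    · rcases ih with h | ⟨a₀, h₀, a₁, h₁, o, ho, rfl⟩
      · exact Or.inl (mul_mem hx h)
      · exact Or.inr ⟨x * a₀, mul_mem hx h₀, a₁, h₁, o, ho, by group⟩
    · exact step x hx y ih
  | inv_mul_cancel x hx y _ ih =>
    rcases hx with hx | hx
    · rcases ih with h | ⟨a₀, h₀, a₁, h₁, o, ho, rfl⟩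
      · exact Or.inl (mul_mem (inv_mem hx) h)
      · exact Or.inr ⟨x⁻¹ * a₀, mul_mem (inv_mem hx) h₀, a₁, h₁, o, ho, by group⟩
    · exact step x⁻¹ (inv_mem hx) y ih

/-- In a tree that is acted on `1`-acylindrically, adjacent edge stabilizers meet trivially. -/
theorem IsAcylindrical.isMalnormalIn (hacyl : IsAcylindrical Γ (bassSerreTree A B) 1)
    (hCA : C ≤ A) (hCB : C ≤ B) (hAB : A ⊓ B ≤ C) :
    IsMalnormalIn C A ∧ IsMalnormalIn C B := by
  have hadj (g : Γ) : (bassSerreTree A B).Adj (Sum.inl (g : Γ ⧸ A)) (Sum.inr (g : Γ ⧸ B)) :=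
    ⟨g, Or.inl ⟨rfl, rfl⟩⟩
  -- Used for the paths `B – A – aB` and `A – B – bA`, which are geodesic because their ends are
  -- distinct and on the same side of a bipartite graph. They are fixed by `a * c * a⁻¹`,
  -- respectively `b * c * b⁻¹`, when this element lies in `C`.
  have hdist {V : Type u} {T : SimpleGraph V} {x y z : V} (hxy : T.Adj x y) (hyz : T.Adj y z)
      (hne : x ≠ z) (hnadj : ¬ T.Adj x z) :
      (SimpleGraph.Walk.cons hxy (.cons hyz .nil)).length = T.dist x z := by
    set p := SimpleGraph.Walk.cons hxy (.cons hyz .nil)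
    have hle : T.dist x z ≤ 2 := SimpleGraph.dist_le p
    have h0 : T.dist x z ≠ 0 := fun h => hne (p.reachable.dist_eq_zero_iff.1 h)
    have h1 : T.dist x z ≠ 1 := fun h => hnadj (SimpleGraph.dist_eq_one_iff_adj.1 h)
    have : p.length = 2 := rfl
    omega
  have hfix {D : Subgroup Γ} (x g : Γ) (hg : x⁻¹ * g * x ∈ D) :
      g • (x : Γ ⧸ D) = (x : Γ ⧸ D) := by
    rw [MulAction.Quotient.smul_coe, smul_eq_mul, eq_comm, QuotientGroup.eq, ← mul_assoc]
    exact hg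
  constructor
  · intro a ha haC c hc hac
    have haB : (Sum.inr ((1 : Γ) : Γ ⧸ B) : (Γ ⧸ A) ⊕ (Γ ⧸ B)) ≠ Sum.inr ((a : Γ) : Γ ⧸ B) := by
      intro h
      rw [Sum.inr.injEq, QuotientGroup.eq] at h
      exact haC (hAB ⟨ha, by simpa using h⟩)
    have e : ((a : Γ) : Γ ⧸ A) = ((1 : Γ) : Γ ⧸ A) := by
      rw [eq_comm, QuotientGroup.eq]; simpa using ha
    have h1 := (hadj 1).symm
    have h2 := hadj a
    rw [e] at h2
    have := hacyl _ _ _ (hdist h1 h2 haB (by rintro ⟨g, ⟨h, -⟩ | ⟨-, h⟩⟩ <;> cases h)) (by simp)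
      (a * c * a⁻¹) (by
        intro z hz
        simp only [SimpleGraph.Walk.support_cons, SimpleGraph.Walk.support_nil,
          List.mem_cons, List.not_mem_nil, or_false] at hz
        rcases hz with rfl | rfl | rfl
        · exact congrArg Sum.inr (hfix 1 _ (by simpa using hCB hac))
        · exact congrArg Sum.inl (hfix 1 _ (by simpa using hCA hac))
        · exact congrArg Sum.inr (hfix a _ (by simpa [mul_assoc] using hCB hc)))
    simpa using this
  · intro b hb hbC c hc hbc
    have hbA : (Sum.inl ((1 : Γ) : Γ ⧸ A) : (Γ ⧸ A) ⊕ (Γ ⧸ B)) ≠ Sum.inl ((b : Γ) : Γ ⧸ A) := by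
      intro h
      rw [Sum.inl.injEq, QuotientGroup.eq] at h
      exact hbC (hAB ⟨by simpa using h, hb⟩)
    have e : ((b : Γ) : Γ ⧸ B) = ((1 : Γ) : Γ ⧸ B) := by
      rw [eq_comm, QuotientGroup.eq]; simpa using hb
    have h1 := hadj 1
    have h2 := (hadj b).symm
    rw [e] at h2
    have := hacyl _ _ _ (hdist h1 h2 hbA (by rintro ⟨g, ⟨-, h⟩ | ⟨h, -⟩⟩ <;> cases h)) (by simp)
      (b * c * b⁻¹) (by
        intro z hz
        simp only [SimpleGraph.Walk.support_cons, SimpleGraph.Walk.support_nil,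
          List.mem_cons, List.not_mem_nil, or_false] at hz
        rcases hz with rfl | rfl | rfl
        · exact congrArg Sum.inl (hfix 1 _ (by simpa using hCA hbc))
        · exact congrArg Sum.inr (hfix 1 _ (by simpa using hCB hbc))
        · exact congrArg Sum.inl (hfix b _ (by simpa [mul_assoc] using hCA hc)))
    simpa using this

end Amalgam

/-! ### Criteria for generating a free product with `A`. -/

section FreeProduct

open Monoid

variable {Γ : Type u} [Group Γ]

/-- Products `γ ^ k₁ * α₁ * γ ^ k₂ * α₂ * ⋯ * γ ^ kᵣ` with nonzero exponents `kᵢ` and nontrivial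
elements `αᵢ` of `A`. -/
inductive IsReducedProduct (A : Subgroup Γ) (γ : Γ) : Γ → Prop
  | zpow {k : ℤ} : k ≠ 0 → IsReducedProduct A γ (γ ^ k)
  | step {k : ℤ} {α x : Γ} : k ≠ 0 → α ∈ A → α ≠ 1 → IsReducedProduct A γ x →
      IsReducedProduct A γ (γ ^ k * α * x)

theorem IsReducedProduct.map {G : Type*} [Group G] {D : Subgroup G} {A : Subgroup Γ} {t x : G}
    (hx : IsReducedProduct D t x) (f : G →* Γ) (hf : ∀ d ∈ D, d ≠ 1 → f d ∈ A ∧ f d ≠ 1) :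
    IsReducedProduct A (f t) (f x) := by
  induction hx with
  | zpow hk => rw [map_zpow]; exact .zpow hk
  | step hk hα hα1 _ ih =>
    rw [map_mul, map_mul, map_zpow]
    exact .step hk (hf _ hα hα1).1 (hf _ hα hα1).2 ih

/-- A group generated by `A` and `t` consists of `A` and of the reduced products,
multiplied by elements of `A` on both sides. -/
theorem mem_or_exists_isReducedProduct {A : Subgroup Γ} {t x : Γ}
    (hx : x ∈ Subgroup.closure ((A : Set Γ) ∪ {t})) :
    x ∈ A ∨ ∃ a₀ ∈ A, ∃ a₁ ∈ A, ∃ y, IsReducedProduct A t y ∧ x = a₀ * y * a₁ := by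
  have hA : ∀ a ∈ A, ∀ x : Γ,
      (x ∈ A ∨ ∃ a₀ ∈ A, ∃ a₁ ∈ A, ∃ y, IsReducedProduct A t y ∧ x = a₀ * y * a₁) →
      (a * x ∈ A ∨ ∃ a₀ ∈ A, ∃ a₁ ∈ A, ∃ y, IsReducedProduct A t y ∧ a * x = a₀ * y * a₁) := by
    rintro a ha x (h | ⟨a₀, h₀, a₁, h₁, y, hy, rfl⟩)
    · exact Or.inl (mul_mem ha h)
    · exact Or.inr ⟨a * a₀, mul_mem ha h₀, a₁, h₁, y, hy, by group⟩
  have ht : ∀ n : ℤ, n ≠ 0 → ∀ x : Γ,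
      (x ∈ A ∨ ∃ a₀ ∈ A, ∃ a₁ ∈ A, ∃ y, IsReducedProduct A t y ∧ x = a₀ * y * a₁) →
      (t ^ n * x ∈ A ∨
        ∃ a₀ ∈ A, ∃ a₁ ∈ A, ∃ y, IsReducedProduct A t y ∧ t ^ n * x = a₀ * y * a₁) := by
    rintro n hn x (h | ⟨a₀, h₀, a₁, h₁, y, hy, rfl⟩)
    · exact Or.inr ⟨1, one_mem A, x, h, t ^ n, .zpow hn, by group⟩
    by_cases h₀1 : a₀ = 1
    · subst h₀1
      cases hy with
      | @zpow k hk =>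
        by_cases hnk : n + k = 0
        · left
          have : t ^ n * (1 * t ^ k * a₁) = t ^ (n + k) * a₁ := by group
          rw [this, hnk, zpow_zero, one_mul]
          exact h₁
        · exact Or.inr ⟨1, one_mem A, a₁, h₁, t ^ (n + k), .zpow hnk, by group⟩
      | @step k α z hk hα hα1 hz =>
        by_cases hnk : n + k = 0
        · refine Or.inr ⟨α, hα, a₁, h₁, z, hz, ?_⟩
          have : t ^ n * (1 * (t ^ k * α * z) * a₁) = t ^ (n + k) * (α * z * a₁) := by group
          rw [this, hnk, zpow_zero, one_mul]
        · exact Or.inr ⟨1, one_mem A, a₁, h₁, t ^ (n + k) * α * z, .step hnk hα hα1 hz, by group⟩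
    · exact Or.inr ⟨1, one_mem A, a₁, h₁, t ^ n * a₀ * y, .step hn h₀ h₀1 hy, by group⟩
  induction hx using Subgroup.closure_induction_left with
  | one => exact Or.inl (one_mem A)
  | mul_left x hx y _ ih =>
    rcases hx with hx | rfl
    · exact hA x hx y ih
    · simpa using ht 1 one_ne_zero y ih
  | inv_mul_cancel x hx y _ ih =>
    rcases hx with hx | rfl
    · exact hA _ (inv_mem hx) y ih
    · simpa using ht (-1) (by norm_num) y ih

/-- `A` and `γ` generate the free product of `A` and an infinite cyclic group. -/
def GeneratesFreeProduct (A : Subgroup Γ) (γ : Γ) : Prop :=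
  Function.Injective (Coprod.lift A.subtype (zpowersHom Γ γ))

theorem generatesFreeProduct_of_forall_not_mem {A : Subgroup Γ} {γ : Γ}
    (h : ∀ x, IsReducedProduct A γ x → x ∉ A) : GeneratesFreeProduct A γ := by
  rw [GeneratesFreeProduct, injective_iff_map_eq_one]
  intro x hx
  set f := Coprod.lift A.subtype (zpowersHom Γ γ)
  let D : Subgroup (Coprod A (Multiplicative ℤ)) := Coprod.inl.range
  let t : Coprod A (Multiplicative ℤ) := Coprod.inr (Multiplicative.ofAdd 1)
  have hf : ∀ d ∈ D, ∃ a : A, d = Coprod.inl a ∧ f d = a := by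
    rintro _ ⟨a, rfl⟩
    exact ⟨a, rfl, Coprod.lift_apply_inl _ _ _⟩
  have hft : f t = γ := by simp [f, t]
  have hmem : ∀ x, x ∈ Subgroup.closure ((D : Set _) ∪ {t}) := by
    intro x
    induction x using Coprod.induction_on with
    | inl a => exact Subgroup.subset_closure (Or.inl ⟨a, rfl⟩)
    | inr n =>
      have : (Coprod.inr n : Coprod A (Multiplicative ℤ)) = t ^ n.toAdd := by
        rw [← map_zpow, ← ofAdd_zsmul]; simp
      rw [this]
      have ht : t ∈ Subgroup.closure ((D : Set _) ∪ {t}) :=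
        Subgroup.subset_closure (Or.inr rfl)
      exact zpow_mem ht _
    | mul x y hx hy => exact mul_mem hx hy
  rcases mem_or_exists_isReducedProduct (hmem x) with hD | ⟨a₀, h₀, a₁, h₁, y, hy, rfl⟩
  · obtain ⟨a, rfl, ha⟩ := hf x hD
    rw [hx] at ha
    rw [show a = 1 from Subtype.ext ha.symm, map_one]
  · exfalso
    refine h (f y) (hft ▸ hy.map f ?_) ?_
    · intro d hd hd1
      obtain ⟨a, rfl, ha⟩ := hf d hd
      refine ⟨ha ▸ a.2, fun h1 => hd1 ?_⟩
      rw [h1] at ha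
      rw [show a = 1 from Subtype.ext ha.symm, map_one]
    · obtain ⟨b₀, -, e₀⟩ := hf a₀ h₀
      obtain ⟨b₁, -, e₁⟩ := hf a₁ h₁
      rw [map_mul, map_mul, e₀, e₁] at hx
      have : f y = (b₀ : Γ)⁻¹ * (b₁ : Γ)⁻¹ := by
        rw [eq_inv_mul_iff_mul_eq, eq_inv_iff_mul_eq_one, hx]
      rw [this]
      exact mul_mem (inv_mem b₀.2) (inv_mem b₁.2)

/-- The map fixing `A` and sending the generator `t` of `ℤ` to `a * t * b` is an automorphism of `A
∗ ℤ`; its inverse uses `a⁻¹` and `b⁻¹`. -/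
theorem GeneratesFreeProduct.mul_mul {A : Subgroup Γ} {γ a b : Γ} (h : GeneratesFreeProduct A γ)
    (ha : a ∈ A) (hb : b ∈ A) : GeneratesFreeProduct A (a * γ * b) := by
  let τ (a b : A) : Coprod A (Multiplicative ℤ) →* Coprod A (Multiplicative ℤ) :=
    Coprod.lift Coprod.inl
      (zpowersHom _ (Coprod.inl a * Coprod.inr (Multiplicative.ofAdd 1) * Coprod.inl b))
  have hτ (a b : A) : (τ a⁻¹ b⁻¹).comp (τ a b) = MonoidHom.id _ := by
    refine Coprod.hom_ext ?_ ?_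
    · ext x; simp [τ]
    · ext
      simp [τ, mul_assoc]
  have e : Coprod.lift A.subtype (zpowersHom Γ (a * γ * b)) =
      (Coprod.lift A.subtype (zpowersHom Γ γ)).comp (τ ⟨a, ha⟩ ⟨b, hb⟩) := by
    refine Coprod.hom_ext ?_ ?_
    · ext x; simp [τ]
    · ext
      simp [τ]
  have hinj : Function.Injective (τ ⟨a, ha⟩ ⟨b, hb⟩) :=
    Function.LeftInverse.injective (g := τ ⟨a, ha⟩⁻¹ ⟨b, hb⟩⁻¹)
      (fun x => DFunLike.congr_fun (hτ ⟨a, ha⟩ ⟨b, hb⟩) x)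
  rw [GeneratesFreeProduct, e]
  exact h.comp hinj

theorem GeneratesFreeProduct.isInternalFreeProduct {A : Subgroup Γ} {γ : Γ}
    (h : GeneratesFreeProduct A γ) :
    IsInternalFreeProduct A (Subgroup.zpowers γ) (Subgroup.closure ((A : Set Γ) ∪ {γ})) := by
  constructor
  · let r : Multiplicative ℤ →* Subgroup.zpowers γ :=
      zpowersHom _ ⟨γ, Subgroup.mem_zpowers γ⟩
    let s : Coprod A (Multiplicative ℤ) →* Coprod A (Subgroup.zpowers γ) :=
      Coprod.map (MonoidHom.id A) r
    have hs : Function.Surjective s := by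
      intro x
      induction x using Coprod.induction_on with
      | inl a => exact ⟨Coprod.inl a, rfl⟩
      | inr z =>
        obtain ⟨_, k, rfl⟩ := z
        refine ⟨Coprod.inr (Multiplicative.ofAdd k), ?_⟩
        simp only [s, Coprod.map_apply_inr]
        congr 1
      | mul x y hx hy =>
        obtain ⟨x', rfl⟩ := hx
        obtain ⟨y', rfl⟩ := hy
        exact ⟨x' * y', map_mul s _ _⟩
    have e : Coprod.lift A.subtype (zpowersHom Γ γ) =
        (Coprod.lift A.subtype (Subgroup.zpowers γ).subtype).comp s := by
      refine Coprod.hom_ext ?_ ?_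
      · ext x; simp [s]
      · ext; simp [s, r]
    rw [GeneratesFreeProduct, e] at h
    intro x y hxy
    obtain ⟨x', rfl⟩ := hs x
    obtain ⟨y', rfl⟩ := hs y
    exact congrArg s (h hxy)
  · rw [Coprod.range_lift, Subgroup.range_subtype, Subgroup.range_subtype,
      Subgroup.closure_union, Subgroup.closure_eq, Subgroup.zpowers_eq_closure]

end FreeProduct

/-! ### The possible shapes of `γ`. -/

section Cases

variable {Γ : Type u} [Group Γ] {A B C : Subgroup Γ}

/-- If the powers of `γ` are alternating products whose first factors lie in `L` and whose last
factors lie in `R`, and if no cancellation occurs between `R`, elements of `C`, and `L`,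
then reduced products are alternating. -/
theorem IsReducedProduct.exists_oddAlternating {γ x : Γ} {L R : Set Γ}
    (hCB : C ≤ B)
    (hL : ∀ y ∈ L, y ∈ B ∧ y ∉ C) (hR : ∀ y ∈ R, y ∈ B ∧ y ∉ C)
    (hpow : ∀ k : ℤ, k ≠ 0 → ∃ l ∈ L, ∃ r ∈ R, ∃ m, OddAlternating C A B m ∧ γ ^ k = l * m * r)
    (hRL : ∀ r ∈ R, ∀ l ∈ L, ∀ c ∈ C, c ≠ 1 → r * c * l ∉ C)
    (hx : IsReducedProduct A γ x) :
    ∃ l ∈ L, ∃ r ∈ R, ∃ m, OddAlternating C A B m ∧ x = l * m * r := by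
  induction hx with
  | zpow hk => exact hpow _ hk
  | @step k α x hk hα hα1 _ ih =>
    obtain ⟨l, hl, r, hr, m, hm, rfl⟩ := ih
    obtain ⟨l', hl', r', hr', m', hm', e⟩ := hpow k hk
    rw [e]
    -- A letter of `C` merges with its neighbours into the single letter `r' * α * l` of `B \ C`;
    -- any other `α` is a letter of its own.
    by_cases hαC : α ∈ C
    · exact ⟨l', hl', r, hr, m' * (r' * α * l) * m, hm'.append
        (mul_mem (mul_mem (hR _ hr').1 (hCB hαC)) (hL _ hl).1) (hRL _ hr' _ hl _ hαC hα1) hm,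
        by group⟩
    · exact ⟨l', hl', r, hr, m' * r' * (α * l * m),
        hm'.append (hR _ hr').1 (hR _ hr').2
          (OddAlternating.append (.single hα hαC) (hL _ hl).1 (hL _ hl).2 hm), by group⟩

theorem generatesFreeProduct_of_pow {γ : Γ} {L R : Set Γ} (hCB : C ≤ B)
    (hnf : ∀ g, OddAlternating C B A g → g ∉ A)
    (hL : ∀ y ∈ L, y ∈ B ∧ y ∉ C) (hR : ∀ y ∈ R, y ∈ B ∧ y ∉ C)
    (hpow : ∀ k : ℤ, k ≠ 0 → ∃ l ∈ L, ∃ r ∈ R, ∃ m, OddAlternating C A B m ∧ γ ^ k = l * m * r)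
    (hRL : ∀ r ∈ R, ∀ l ∈ L, ∀ c ∈ C, c ≠ 1 → r * c * l ∉ C) :
    GeneratesFreeProduct A γ := by
  refine generatesFreeProduct_of_forall_not_mem fun x hx => ?_
  obtain ⟨l, hl, r, hr, m, hm, rfl⟩ := hx.exists_oddAlternating hCB hL hR hpow hRL
  exact hnf _ (.wrap (hL _ hl).1 (hL _ hl).2 hm (hR _ hr).1 (hR _ hr).2)

theorem generatesFreeProduct_of_noncancelling {p m q : Γ} (hCB : C ≤ B)
    (hnf : ∀ g, OddAlternating C B A g → g ∉ A) (hB : IsMalnormalIn C B)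
    (hp : p ∈ B) (hpC : p ∉ C) (hq : q ∈ B) (hqC : q ∉ C)
    (hm : OddAlternating C A B m) (hqp : ∀ c ∈ C, q * c * p ∉ C) :
    GeneratesFreeProduct A (p * m * q) := by
  have hpi : p⁻¹ ∈ B ∧ p⁻¹ ∉ C := ⟨inv_mem hp, by simpa using hpC⟩
  have hqi : q⁻¹ ∈ B ∧ q⁻¹ ∉ C := ⟨inv_mem hq, by simpa using hqC⟩
  refine generatesFreeProduct_of_pow (L := {p, q⁻¹}) (R := {q, p⁻¹}) hCB hnf ?_ ?_ ?_ ?_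
  · rintro y (rfl | rfl)
    exacts [⟨hp, hpC⟩, hqi]
  · rintro y (rfl | rfl)
    exacts [⟨hq, hqC⟩, hpi]
  · intro k hk
    have h (n : ℕ) := OddAlternating.exists_pow_eq hp hq
      (by simpa using hqp 1 (one_mem C)) hm n
    obtain ⟨n, rfl | rfl⟩ := k.eq_nat_or_neg
    all_goals
      obtain ⟨n, rfl⟩ := Nat.exists_eq_succ_of_ne_zero (n := n) (by rintro rfl; simp at hk)
      obtain ⟨z, hz, e⟩ := h n
    · exact ⟨p, Or.inl rfl, q, Or.inl rfl, z, hz, by rw [zpow_natCast]; exact e⟩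
    · refine ⟨q⁻¹, Or.inr rfl, p⁻¹, Or.inr rfl, z⁻¹, hz.inv, ?_⟩
      rw [zpow_neg, zpow_natCast, Nat.succ_eq_add_one, e]
      group
  -- Powers of equal sign meet in `q * c * p` or in the inverse of `q * c⁻¹ * p`; powers of opposite
  -- sign meet in a conjugate of `c`, excluded by malnormality.
  · rintro r (rfl | rfl) l (rfl | rfl) c hc hc1 h
    · exact hqp c hc h
    · exact hc1 (hB _ hq hqC c hc h)
    · exact hc1 (hB _ hpi.1 hpi.2 c hc (by simpa using h))
    · refine hqp c⁻¹ (inv_mem hc) ?_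
      rw [← inv_mem_iff]
      simpa [mul_assoc] using h

theorem generatesFreeProduct_conj {p m : Γ} (hCA : C ≤ A) (hCB : C ≤ B)
    (hnf : ∀ g, OddAlternating C B A g → g ∉ A) (hA : IsMalnormalIn C A) (hB : IsMalnormalIn C B)
    (htf : ∀ (g : Γ) (n : ℕ), g ^ (n + 1) = 1 → g = 1)
    (hp : p ∈ B) (hpC : p ∉ C) (hm : OddAlternating C A B m) :
    GeneratesFreeProduct A (p * m * p⁻¹) := by
  have hpi : p⁻¹ ∈ B ∧ p⁻¹ ∉ C := ⟨inv_mem hp, by simpa using hpC⟩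
  refine generatesFreeProduct_of_pow (L := {p}) (R := {p⁻¹}) hCB hnf ?_ ?_ ?_ ?_
  · rintro y rfl
    exact ⟨hp, hpC⟩
  · rintro y rfl
    exact hpi
  · intro k hk
    exact ⟨p, rfl, p⁻¹, rfl, m ^ k, hm.zpow hCA hCB hA hB htf hk, conj_zpow⟩
  · rintro r rfl l rfl c hc hc1 h
    exact hc1 (hB _ hpi.1 hpi.2 c hc (by simpa using h))

/-- Each maximal stretch of powers of `b` and letters of `C` multiplies to one letter of `B \ C`;
these alternate with the letters of `A \ C`. -/
theorem generatesFreeProduct_of_mem {b : Γ}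
    (hnf : ∀ g, OddAlternating C B A g → g ∉ A) (hCB : C ≤ B) (hb : b ∈ B)
    (hC : ∀ x, IsReducedProduct C b x → x ∉ C) : GeneratesFreeProduct A b := by
  have hB : ∀ x, IsReducedProduct C b x → x ∈ B := by
    intro x hx
    induction hx with
    | zpow _ => exact zpow_mem hb _
    | step _ hα _ _ ih => exact mul_mem (mul_mem (zpow_mem hb _) (hCB hα)) ih
  have key : ∀ x, IsReducedProduct A b x → IsReducedProduct C b x ∨
      ∃ d α z, IsReducedProduct C b d ∧ α ∈ A ∧ α ∉ C ∧ OddAlternating C B A z ∧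
        x = d * α * z := by
    intro x hx
    induction hx with
    | zpow hk => exact Or.inl (.zpow hk)
    | @step k α x hk hα hα1 _ ih =>
      by_cases hαC : α ∈ C
      · rcases ih with ih | ⟨d, β, z, hd, hβ, hβC, hz, rfl⟩
        · exact Or.inl (.step hk hαC hα1 ih)
        · exact Or.inr ⟨b ^ k * α * d, β, z, .step hk hαC hα1 hd, hβ, hβC, hz, by group⟩
      · refine Or.inr ⟨b ^ k, α, x, .zpow hk, hα, hαC, ?_, rfl⟩
        rcases ih with ih | ⟨d, β, z, hd, hβ, hβC, hz, rfl⟩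
        · exact .single (hB _ ih) (hC _ ih)
        · exact OddAlternating.append (.single (hB _ hd) (hC _ hd)) hβ hβC hz
  refine generatesFreeProduct_of_forall_not_mem fun x hx => hnf x ?_
  rcases key x hx with h | ⟨d, β, z, hd, hβ, hβC, hz, rfl⟩
  · exact .single (hB _ h) (hC _ h)
  · exact OddAlternating.append (.single (hB _ hd) (hC _ hd)) hβ hβC hz

end Cases

/-! ### Limit groups: torsion-freeness and free subgroups of rank two. -/

section LimitGroup

open Monoid

variable {Γ : Type u} [Group Γ]

theorem IsLimitGroup.eq_one_of_pow_eq_one (hΓ : IsLimitGroup Γ) (g : Γ) (n : ℕ)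
    (h : g ^ (n + 1) = 1) : g = 1 := by
  classical
  obtain ⟨X, φ, hφ⟩ := hΓ.2 {g, 1}
  refine hφ (by simp) (by simp) ?_
  rw [map_one, ← pow_eq_one_iff_left (n.succ_ne_zero), ← map_pow, Nat.succ_eq_add_one, h, map_one]

/-- Two elements of a limit group which do not commute generate a free group of rank two. -/
theorem IsLimitGroup.lift_injective (hΓ : IsLimitGroup Γ) (x : Bool → Γ)
    (hx : x true * x false ≠ x false * x true) : Function.Injective (FreeGroup.lift x) := by
  classical
  obtain ⟨X, φ, hφ⟩ := hΓ.2 {x true * x false, x false * x true}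
  have h := FreeGroup.lift_injective_of_not_commute (fun b => φ (x b)) (fun h => hx (by
    rw [← map_mul, ← map_mul] at h
    exact hφ (by simp) (by simp) h))
  have e : FreeGroup.lift (fun b => φ (x b)) = φ.comp (FreeGroup.lift x) := by
    ext b; simp
  rw [e] at h
  exact Function.Injective.of_comp h

theorem Monoid.CoprodI.NeWord.prod_ne_one {ι : Type*} {G : ι → Type*} [∀ i, Group (G i)] {i j : ι}
    (w : CoprodI.NeWord G i j) : w.prod ≠ 1 := by
  classical
  intro h
  have : w.toWord = CoprodI.Word.empty := by
    apply (CoprodI.Word.equiv (M := G)).symm.injective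
    change w.toWord.prod = CoprodI.Word.empty.prod
    rw [CoprodI.Word.prod_empty]; exact h
  exact w.toList_ne_nil (congrArg CoprodI.Word.toList this)

theorem IsReducedProduct.not_mem_of_freeGroup {t s : Γ} {x : Γ}
    (hinj : Function.Injective (FreeGroup.lift (fun i : Bool => cond i t s)))
    (hx : IsReducedProduct (Subgroup.zpowers s) t x) : x ∉ Subgroup.zpowers s := by
  set f := FreeGroup.lift (fun i : Bool => cond i t s) with hf
  let G : Bool → Type := fun _ => Multiplicative ℤ
  -- In `ℤ ∗ ℤ` a reduced product becomes a reduced word ending in the `true` factor, so multiplying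
  -- by a power of the other generator cannot make it trivial.
  let θ : FreeGroup Bool →* CoprodI G :=
    FreeGroup.lift fun i => CoprodI.of (i := i) (Multiplicative.ofAdd (1 : ℤ) : G i)
  have hθ (i : Bool) (k : ℤ) :
      θ (FreeGroup.of i ^ k) = CoprodI.of (i := i) (Multiplicative.ofAdd k : G i) := by
    rw [map_zpow, FreeGroup.lift_apply_of, ← map_zpow]
    congr 1
    change Multiplicative.ofAdd (1 : ℤ) ^ k = _
    rw [← ofAdd_zsmul]; simp
  have hone (k : ℤ) (hk : k ≠ 0) (i : Bool) : (Multiplicative.ofAdd k : G i) ≠ 1 := by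
    intro h; exact hk (Multiplicative.ofAdd.injective h)
  have key : ∃ v, f v = x ∧ ∃ w : CoprodI.NeWord G true true, w.prod = θ v := by
    induction hx with
    | @zpow k hk =>
      refine ⟨FreeGroup.of true ^ k, by simp [hf], .singleton _ (hone k hk true), ?_⟩
      rw [CoprodI.NeWord.prod_singleton, hθ]
    | @step k α x hk hα hα1 _ ih =>
      obtain ⟨v, rfl, w, hw⟩ := ih
      obtain ⟨l, rfl⟩ := hα
      have hl : l ≠ 0 := by rintro rfl; simp at hα1
      refine ⟨FreeGroup.of true ^ k * FreeGroup.of false ^ l * v, by simp [hf],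
        .append (.append (.singleton _ (hone k hk true)) (by decide : true ≠ false)
          (.singleton _ (hone l hl false))) (by decide : false ≠ true) w, ?_⟩
      simp only [CoprodI.NeWord.append_prod, CoprodI.NeWord.prod_singleton, hw, map_mul, hθ]
  rintro ⟨l, rfl⟩
  obtain ⟨v, hv, w, hw⟩ := key
  have hv' : v = FreeGroup.of false ^ l := hinj (by rw [hv]; simp [hf])
  rw [hv'] at hw
  by_cases hl : l = 0
  · subst hl
    exact w.prod_ne_one (by rw [hw]; simp)
  · refine (CoprodI.NeWord.append w (by decide : true ≠ false)
      (.singleton _ (hone (-l) (neg_ne_zero.2 hl) false))).prod_ne_one ?_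
    rw [CoprodI.NeWord.append_prod, CoprodI.NeWord.prod_singleton, hw, ← hθ, ← map_mul]
    simp

theorem IsLimitGroup.not_mem_of_isReducedProduct (hΓ : IsLimitGroup Γ) {B C : Subgroup Γ}
    (hC : IsCyclic C) (hB : IsMalnormalIn C B) {b x : Γ} (hb : b ∈ B) (hbC : b ∉ C)
    (hx : IsReducedProduct C b x) : x ∉ C := by
  obtain ⟨c, rfl⟩ := (Subgroup.isCyclic_iff_exists_zpowers_eq_top C).1 hC
  have hb1 : b ≠ 1 := by rintro rfl; exact hbC (one_mem _)
  by_cases hc : c = 1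
  · subst hc
    cases hx with
    | @zpow k hk =>
      simp only [Subgroup.zpowers_one_eq_bot, Subgroup.mem_bot]
      intro h
      obtain ⟨n, rfl | rfl⟩ := k.eq_nat_or_neg
      all_goals
        obtain ⟨n, rfl⟩ := Nat.exists_eq_succ_of_ne_zero (n := n) (by rintro rfl; simp at hk)
        refine hb1 (hΓ.eq_one_of_pow_eq_one b n ?_)
      · rwa [zpow_natCast] at h
      · rwa [zpow_neg, inv_eq_one, zpow_natCast] at h
    | step _ hα hα1 _ => exact absurd (by simpa using hα) hα1
  · refine hx.not_mem_of_freeGroup (hΓ.lift_injective _ fun h => hc ?_)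
    have h' : b * c = c * b := h
    exact hB b hb hbC c (Subgroup.mem_zpowers c) (by
      rw [h', mul_inv_cancel_right]; exact Subgroup.mem_zpowers c)

end LimitGroup

theorem theorem4p1 {Γ : Type u} [Group Γ] (hΓ : IsLimitGroup Γ)
    (A B C : Subgroup Γ) (hABC : IsAmalgamatedProduct A B C) (hC : IsCyclic C)
    (hacyl : IsAcylindrical Γ (bassSerreTree A B) 1)
    (γ : Γ) (hγ : γ ∉ A) :
    IsInternalFreeProduct A (Subgroup.zpowers γ) (Subgroup.closure ((A : Set Γ) ∪ {γ})) := by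
  apply GeneratesFreeProduct.isInternalFreeProduct
  obtain ⟨hCA, hCB, hnf', hnf, hgen⟩ := hABC.normal_form
  have hAB : A ⊓ B ≤ C := fun x hx => by
    by_contra hxC
    exact hnf' x (.single hx.1 hxC) hx.2
  obtain ⟨hA, hB⟩ := hacyl.isMalnormalIn hCA hCB hAB
  have htf := hΓ.eq_one_of_pow_eq_one
  obtain ⟨a₀, h₀, a₁, h₁, o, ho, rfl⟩ :=
    (exists_oddAlternating_of_not_mem hCA hCB hgen γ).resolve_left hγ
  refine GeneratesFreeProduct.mul_mul ?_ h₀ h₁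
  cases ho with
  | single hb hbC =>
    exact generatesFreeProduct_of_mem hnf hCB hb
      fun x hx => hΓ.not_mem_of_isReducedProduct hC hB hb hbC hx
  | wrap hp hpC hm hq hqC =>
    rename_i p m q
    by_cases hqp : ∀ c ∈ C, q * c * p ∉ C
    · exact generatesFreeProduct_of_noncancelling hCB hnf hB hp hpC hq hqC hm hqp
    · push Not at hqp
      obtain ⟨c, hc, hd⟩ := hqp
      -- The conjugated word is still alternating, as `q * c * p ∈ C` is absorbed by the last letter
      -- of `m`; the stray `c⁻¹` lies in `A`.
      have e : p * m * q = 1 * (p * (m * (q * c * p)) * p⁻¹) * c⁻¹ := by group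
      rw [e]
      exact (generatesFreeProduct_conj hCA hCB hnf hA hB htf hp hpC
        (hm.mul_base hCA hd)).mul_mul (one_mem A) (hCA (inv_mem hc))
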